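/- A loopless mixed graph on a finite node set $V$ has edges of three types between distinct nodes: arrows $i\to j$, arcs $i\leftrightarrow j$ and lines $i - j$. An arrow $i\to j$ has an arrowhead at $j$, an arc has arrowheads at both of its endpoints, a line has none. An inner node of a path is a collider on the path if both path edges at it have an arrowhead at it. For a set $S$ of nodes, $\mathrm{pa}(S)$ is the set of nodes $u$ with an arrow $u\to v$ for some $v\in S$, and $\mathrm{an}(S)$ the set of nodes from which a directed path of arrows leads to a node of $S$. For pairwise disjoint $A,B,C\subseteq V$, $A$ and $B$ are $m$-separated by $C$ if there is no path between a node of $A$ and a node of $B$ all of whose colliders are in $C\cup\mathrm{an}(C)$ and all of whose inner non-colliders are outside $C$. Two graphs on $V$ are Markov equivalent if they have the same $m$-separations. A DAG is a graph with arrows only and without directed cycles. A regression chain graph $H$ is a loopless mixed graph in which no arrowhead points to an endpoint of a line, and in which there is no closed walk that consists of arrows, at least one, all in the same direction, and possibly of arcs. Then there are numbered, pairwise disjoint node sets $\tau_1,\dots,\tau_T$ (chain components), containing together all endpoints of arrows and arcs, such that every arc lies within one $\tau_i$ and every arrow goes from some $\tau_i$ to some $\tau_j$ with $j<i$. A collider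 $P_4$ in a graph is a path $\langle a,b,c,d\rangle$ with four distinct nodes on which both $b$ and $c$ are colliders, such that $a,c$ are not adjacent, $b,d$ are not adjacent, and $a,d$ are not adjacent. A collider $C_4$ is the same except that $a,d$ are adjacent (by an edge of any type). $H[-]$ denotes the undirected graph formed by the lines of $H$; it is chordal if it has no chordless cycle with $n\ge 4$ nodes as an induced subgraph. **Corollary.** Let $H$ be a regression chain graph on a finite node set, with chain components $\tau_1,\dots,\tau_T$ as above. Then $H$ is Markov equivalent to a DAG on the same node set if and only if $H[-]$ is chordal and, for every $1\le i\le T$, the subgraph of $H$ induced by $\tau_i\cup\mathrm{pa}(\tau_i)$ contains neither a collider $P_4$ nor a collider $C_4$ as an induced subgraph. -/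

import Mathlib

/-- A loopless mixed graph on the node set `V`: arrows (`arrow i j` is `i → j`), arcs
(two-headed arrows `i ↔ j`) and lines (`i — j`), without loops. -/
structure LooplessMixedGraph (V : Type*) where
  arrow : V → V → Prop
  arc : V → V → Prop
  line : V → V → Prop
  arc_symm : ∀ i j, arc i j → arc j i
  line_symm : ∀ i j, line i j → line j i
  arrow_irrefl : ∀ i, ¬ arrow i i
  arc_irrefl : ∀ i, ¬ arc i i
  line_irrefl : ∀ i, ¬ line i i

namespace LooplessMixedGraph

/-- The way in which an edge is traversed from a node `u` to a node `v`:
`u → v`, `u ← v`, `u ↔ v`, `u — v`. -/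
inductive EdgeKind where
  | forward
  | backward
  | arc
  | line

/-- The traversed edge has an arrowhead at the node in which the traversal ends. -/
def EdgeKind.HeadAtEnd : EdgeKind → Prop
  | .forward => True
  | .backward => False
  | .arc => True
  | .line => False

/-- The traversed edge has an arrowhead at the node from which the traversal starts. -/
def EdgeKind.HeadAtStart : EdgeKind → Prop
  | .forward => False
  | .backward => True
  | .arc => True
  | .line => False

variable {V : Type*}

/-- `H` has an edge that is traversed from `u` to `v` in the way `k`. -/
def HasEdge (H : LooplessMixedGraph V) : EdgeKind → V → V → Prop
  | .forward, u, v => H.arrow u v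
  | .backward, u, v => H.arrow v u
  | .arc, u, v => H.arc u v
  | .line, u, v => H.line u v

/-- Adjacency: `u` and `v` are the endpoints of some edge. -/
def Adj (H : LooplessMixedGraph V) (u v : V) : Prop :=
  H.arrow u v ∨ H.arrow v u ∨ H.arc u v ∨ H.line u v

/-- There is an edge between `u` and `v` with an arrowhead pointing to `v`: `u → v` or `u ↔ v`. -/
def HeadTo (H : LooplessMixedGraph V) (u v : V) : Prop :=
  H.arrow u v ∨ H.arc u v

/-- The set of parents of the nodes in `S`. -/
def pa (H : LooplessMixedGraph V) (S : Set V) : Set V :=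
  {u | ∃ v ∈ S, H.arrow u v}

/-- The set of ancestors of the nodes in `S`. -/
def an (H : LooplessMixedGraph V) (S : Set V) : Set V :=
  {u | ∃ v ∈ S, Relation.TransGen H.arrow u v}

/-- The subgraph of `H` induced by the node set `S`. -/
def induce (H : LooplessMixedGraph V) (S : Set V) : LooplessMixedGraph S where
  arrow i j := H.arrow i j
  arc i j := H.arc i j
  line i j := H.line i j
  arc_symm i j := H.arc_symm i j
  line_symm i j := H.line_symm i j
  arrow_irrefl i := H.arrow_irrefl i
  arc_irrefl i := H.arc_irrefl i
  line_irrefl i := H.line_irrefl i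

/-- The subgraph formed by the lines of `H`, as a simple graph. -/
def lineSubgraph (H : LooplessMixedGraph V) : SimpleGraph V where
  Adj := H.line
  symm := ⟨H.line_symm⟩
  loopless := ⟨H.line_irrefl⟩

/-- A walk: a list of nodes and of edges between consecutive nodes. -/
inductive Walk (H : LooplessMixedGraph V) : V → V → Type _
  | nil (u : V) : Walk H u u
  | cons {u v w : V} (k : EdgeKind) (h : H.HasEdge k u v) (p : Walk H v w) : Walk H u w

/-- The list of the nodes of a walk. -/
def Walk.support {H : LooplessMixedGraph V} : {u v : V} → H.Walk u v → List V
  | _, _, .nil u => [u]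
  | u, _, .cons _ _ p => u :: p.support

/-- A path is a walk without repeated nodes. -/
def Walk.IsPath {H : LooplessMixedGraph V} {u v : V} (p : H.Walk u v) : Prop :=
  p.support.Nodup

/-- All inner collider nodes of the walk are in `C ∪ an(C)` and all its inner non-collider nodes
are outside `C`. An inner node is a collider if both walk edges at it have an arrowhead there. -/
def Walk.IsMConnecting {H : LooplessMixedGraph V} (C : Set V) :
    {u v : V} → H.Walk u v → Prop
  | _, _, .nil _ => True
  | _, _, .cons _ _ (.nil _) => True
  | _, _, .cons (v := v) k _ (.cons k' h' p) =>
      ((k.HeadAtEnd ∧ k'.HeadAtStart) → v ∈ C ∪ H.an C) ∧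
      (¬ (k.HeadAtEnd ∧ k'.HeadAtStart) → v ∉ C) ∧
      Walk.IsMConnecting C (.cons k' h' p)

/-- `A` and `B` are m-separated by `C`: no path between a node of `A` and a node of `B` is
m-connecting given `C`. -/
def MSep (H : LooplessMixedGraph V) (A B C : Set V) : Prop :=
  ∀ a ∈ A, ∀ b ∈ B, ∀ p : H.Walk a b, p.IsPath → ¬ p.IsMConnecting C

/-- Two graphs on the same node set are Markov equivalent if they have the same m-separations
among disjoint node sets. -/
def MarkovEquivalent (G H : LooplessMixedGraph V) : Prop :=
  ∀ A B C : Set V, Disjoint A B → Disjoint A C → Disjoint B C →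
    (G.MSep A B C ↔ H.MSep A B C)

/-- Directed acyclic graph: all edges are arrows and there is no direction-preserving cycle. -/
structure IsDAG (G : LooplessMixedGraph V) : Prop where
  no_arc : ∀ i j, ¬ G.arc i j
  no_line : ∀ i j, ¬ G.line i j
  acyclic : ∀ i, ¬ Relation.TransGen G.arrow i i

/-- Regression chain graph: no arrowhead points to an endpoint of a line, and there is no cycle
that consists of arrows, at least one, all in the same direction, and possibly of arcs: after an
arrow `i → j` one cannot get back from `j` to `i` along arrows (traversed forwards) and arcs. -/
structure IsRegressionChainGraph (H : LooplessMixedGraph V) : Prop where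
  no_head_to_line : ∀ i j k, H.HeadTo i j → ¬ H.line j k
  no_cycle : ∀ i j, H.arrow i j → ¬ Relation.ReflTransGen H.HeadTo j i

/-- `τ` is a numbered family of chain components: disjoint sets that cover all endpoints of arrows
and arcs, such that every arc is within one of them, and every arrow is between two of them and
points from the higher number to the lower. (Nodes without arrows and arcs may, but need not,
belong to the sets.) -/
structure IsChainPartition (H : LooplessMixedGraph V) {T : ℕ} (τ : Fin T → Set V) : Prop where
  disjoint : Pairwise fun i j => Disjoint (τ i) (τ j)
  cover : ∀ u v, H.HeadTo u v → (∃ i, u ∈ τ i) ∧ (∃ i, v ∈ τ i)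
  arc_within : ∀ i j u v, u ∈ τ i → v ∈ τ j → H.arc u v → i = j
  arrow_between : ∀ i j u v, u ∈ τ i → v ∈ τ j → H.arrow u v → j < i

/-- `⟨a, b, c, d⟩` is a path both of whose inner nodes `b`, `c` are colliders. -/
def IsColliderPathFour (H : LooplessMixedGraph V) (a b c d : V) : Prop :=
  [a, b, c, d].Nodup ∧ H.HeadTo a b ∧ H.arc b c ∧ H.HeadTo d c

/-- `H` has a collider `P₄` as an induced subgraph: a collider path with four nodes, with no edge
between nodes that are not consecutive on it. -/
def HasInducedColliderP4 (H : LooplessMixedGraph V) : Prop :=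
  ∃ a b c d, H.IsColliderPathFour a b c d ∧ ¬ H.Adj a c ∧ ¬ H.Adj b d ∧ ¬ H.Adj a d

/-- `H` has a collider `C₄` as an induced subgraph: a chordless cycle formed by a collider path
with four nodes and an edge, of any type, between its endpoints. -/
def HasInducedColliderC4 (H : LooplessMixedGraph V) : Prop :=
  ∃ a b c d, H.IsColliderPathFour a b c d ∧ ¬ H.Adj a c ∧ ¬ H.Adj b d ∧ H.Adj a d

end LooplessMixedGraph

/-- A simple graph is chordal if it has no cycle with at least four nodes as an induced
subgraph. -/
def SimpleGraph.IsChordalGraph {V : Type*} (G : SimpleGraph V) : Prop :=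
  ∀ n : ℕ, 4 ≤ n → IsEmpty (SimpleGraph.cycleGraph n ↪g G)

/-! Regression chain graphs and DAGs are simple: the marks of an edge depend only on its two
endpoints. So m-connection can be expressed by node sequences, with colliders in C and non-colliders
outside C (`Conn`, `mSep_iff`). Repeated nodes are allowed, which absorbs the clause about an(C): a
collider with a descendant in C is replaced by a trip down to C and back.

Necessity. Non-adjacent nodes can be separated (`exists_not_conn`), so Markov equivalent graphs have
the same adjacencies and the same unshielded colliders (`collider_iff`). On a collider P4 or C4 both
inner triples are unshielded colliders, and a DAG would need b → c and c → b. A chordless cycle of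
lines would have a sink in the DAG, hence an unshielded collider that is absent from H.

Sufficiency. All edges are oriented towards the higher rank of a suitable ranking
(`IsPerfectRanking`). Arrows keep their direction; lines follow a perfect elimination order, which
exists by Dirac's lemma on simplicial nodes; arcs point towards the larger set of incoming
neighbours. Without collider P4 and C4 these sets are nested along arcs (`closedHeads_subset_or`),
so such a ranking exists. The orientation is Markov equivalent to H because a shortest connecting
walk of one graph connects in the other: a triple that is open in one graph only is always bridged
by edges that allow a shorter walk (`conn_orient`, `conn_of_conn_orient`). -/

/-! ### Walks with a condition on consecutive triples, and their shortening. -/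

/-- `HalfWalk R P a n y b`: there is a walk along `R` with `n + 1` edges that starts in `a`, has
`y, b` as its last two nodes, and all of whose triples of consecutive nodes satisfy `P`. -/
inductive HalfWalk {V : Type*} (R : V → V → Prop) (P : V → V → V → Prop) (a : V) :
    ℕ → V → V → Prop
  | single {b : V} (h : R a b) : HalfWalk R P a 0 a b
  | step {n : ℕ} {y b x : V} (h : HalfWalk R P a n y b) (hR : R b x) (hP : P y b x) :
      HalfWalk R P a (n + 1) b x

namespace HalfWalk

variable {V : Type*} {R : V → V → Prop} {P Q : V → V → V → Prop} {a c : V}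

theorem rel {n : ℕ} {y b : V} (h : HalfWalk R P a n y b) : R y b := by
  cases h <;> assumption

theorem replace_last {n : ℕ} {y b x : V} (h : HalfWalk R P a n y b) (hR : R y x)
    (hP : ∀ z, R z y → P z y b → P z y x) : HalfWalk R P a n y x := by
  cases h with
  | single h => exact .single hR
  | step h hR' hP' => exact h.step hR (hP _ h.rel hP')

theorem join (hP : ∀ y b x, P y b x → P x b y) {n m : ℕ} {y b : V}
    (h₁ : HalfWalk R P a n y b) (h₂ : HalfWalk R P c m b y) (hR : ∀ x y, R x y → R y x) :
    ∃ x, HalfWalk R P a (n + m) x c := by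
  induction m generalizing n y b with
  | zero => cases h₂; exact ⟨_, h₁⟩
  | succ m ih =>
    cases h₂ with
    | step h hR' hP' =>
      obtain ⟨x, hx⟩ := ih (h₁.step (hR _ _ h.rel) (hP _ _ _ hP')) h
      exact ⟨x, by rwa [show n + (m + 1) = n + 1 + m by omega]⟩

theorem reverse (hP : ∀ y b x, P y b x → P x b y) (hR : ∀ x y, R x y → R y x) {n : ℕ} {y : V}
    (h : HalfWalk R P a n y c) : ∃ x, HalfWalk R P c n x a := by
  obtain ⟨x, hx⟩ := join hP (.single (hR _ _ h.rel)) h hR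
  exact ⟨x, by rwa [Nat.zero_add] at hx⟩

/-- The two half-walks overlap in one edge. Moving that overlap along the walk meets every triple,
and a bad one is returned with the pieces on both sides. -/
theorem or_exists_bad (hP : ∀ y b x, P y b x → P x b y) (hR : ∀ x y, R x y → R y x)
    {n m : ℕ} {y b : V} (h₁ : HalfWalk R P a n y b) (h₂ : HalfWalk R P c m b y) :
    HalfWalk R Q a n y b ∨ ∃ i j y b x, HalfWalk R P a i y b ∧ HalfWalk R P c j x b ∧
      P y b x ∧ ¬ Q y b x ∧ i + j + 1 = n + m := by
  induction h₁ generalizing m with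
  | single h => exact .inl (.single h)
  | @step n y b x h hR' hP' ih =>
    by_cases hQ : Q y b x
    · rcases ih (h₂.step (hR _ _ h.rel) (hP _ _ _ hP')) with h' | ⟨i, j, y, b, x, h1, h2, h3, h4, h5⟩
      · exact .inl (h'.step hR' hQ)
      · exact .inr ⟨i, j, y, b, x, h1, h2, h3, h4, by omega⟩
    · exact .inr ⟨n, m, y, b, x, h, h₂, hP', hQ, by omega⟩

/-- If a walk with a triple that violates `Q` can always be shortened, then a shortest walk
satisfies `Q` throughout. -/
theorem exists_of_shorten (hP : ∀ y b x, P y b x → P x b y) (hR : ∀ x y, R x y → R y x)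
    (hshort : ∀ (i j : ℕ) (y b x : V), HalfWalk R P a i y b → HalfWalk R P c j x b → P y b x →
      ¬ Q y b x → ∃ k < i + j + 1, ∃ z, HalfWalk R P a k z c)
    {n : ℕ} {y : V} (h : HalfWalk R P a n y c) : ∃ m z, HalfWalk R Q a m z c := by
  induction n using Nat.strong_induction_on generalizing y with
  | _ n ih =>
    rcases or_exists_bad (Q := Q) hP hR h (.single (hR _ _ h.rel)) with
      h' | ⟨i, j, y, b, x, h1, h2, h3, h4, h5⟩
    · exact ⟨_, _, h'⟩
    · obtain ⟨k, hk, z, hz⟩ := hshort i j y b x h1 h2 h3 h4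
      exact ih k (by omega) hz

/-- Leave out the middle node of a triple. -/
theorem shortcut (hP : ∀ y b x, P y b x → P x b y) (hR : ∀ x y, R x y → R y x)
    {i j : ℕ} {y b x : V} (h₁ : HalfWalk R P a i y b) (h₂ : HalfWalk R P c j x b) (h : R y x)
    (hy : ∀ z, R z y → P z y b → P z y x) (hx : ∀ w, R w x → P w x b → P w x y) :
    ∃ k < i + j + 1, ∃ z, HalfWalk R P a k z c :=
  ⟨i + j, by omega, join hP (h₁.replace_last h hy) (h₂.replace_last (hR _ _ h) hx) hR⟩

/-- Leave out a detour from a node to a neighbour and back. -/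
theorem shortcut_back (hP : ∀ y b x, P y b x → P x b y) (hR : ∀ x y, R x y → R y x) (hac : a ≠ c)
    {i j : ℕ} {y b : V} (h₁ : HalfWalk R P a i y b) (h₂ : HalfWalk R P c j y b)
    (hy : ∀ z w, R z y → R w y → P z y b → P w y b → P z y w) :
    ∃ k < i + j + 1, ∃ z, HalfWalk R P a k z c := by
  cases h₁ with
  | single h =>
    cases h₂ with
    | single h' => exact absurd rfl hac
    | step h' hR' hP' =>
      obtain ⟨z, hz⟩ := h'.reverse hP hR
      exact ⟨_, by omega, z, hz⟩
  | step h hR₁ hP₁ =>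
    cases h₂ with
    | single h' => exact ⟨_, by omega, _, h⟩
    | step h' hR' hP' =>
      obtain ⟨z, hz⟩ := join hP (h.step (hR _ _ h'.rel) (hy _ _ h.rel h'.rel hP₁ hP')) h' hR
      exact ⟨_, by omega, z, hz⟩

end HalfWalk

/-! ### Connecting walks and m-connecting paths. -/

namespace LooplessMixedGraph

variable {V : Type*} {H G : LooplessMixedGraph V} {C : Set V}

theorem Adj.symm {u v : V} (h : H.Adj u v) : H.Adj v u := by
  rcases h with h | h | h | h
  · exact .inr (.inl h)
  · exact .inl h
  · exact .inr (.inr (.inl (H.arc_symm _ _ h)))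
  · exact .inr (.inr (.inr (H.line_symm _ _ h)))

theorem HeadTo.adj {u v : V} (h : H.HeadTo u v) : H.Adj u v := by
  rcases h with h | h
  · exact .inl h
  · exact .inr (.inr (.inl h))

theorem not_adj_self (v : V) : ¬ H.Adj v v := by
  rintro (h | h | h | h)
  exacts [H.arrow_irrefl _ h, H.arrow_irrefl _ h, H.arc_irrefl _ h, H.line_irrefl _ h]

theorem Adj.cases {u v : V} (h : H.Adj u v) : H.HeadTo u v ∨ H.arrow v u ∨ H.line u v := by
  rcases h with h | h | h | h
  · exact .inl (.inl h)
  · exact .inr (.inl h)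
  · exact .inl (.inr h)
  · exact .inr (.inr h)

theorem IsRegressionChainGraph.not_headTo_of_arrow (hH : H.IsRegressionChainGraph) {u v : V}
    (h : H.arrow u v) : ¬ H.HeadTo v u :=
  fun h' => hH.no_cycle _ _ h (.single h')

theorem IsRegressionChainGraph.not_headTo_of_line (hH : H.IsRegressionChainGraph) {u v w : V}
    (h : H.line u v) : ¬ H.HeadTo w u :=
  fun h' => hH.no_head_to_line _ _ _ h' h

theorem IsRegressionChainGraph.not_headTo_of_line' (hH : H.IsRegressionChainGraph) {u v w : V}
    (h : H.line u v) : ¬ H.HeadTo w v :=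
  hH.not_headTo_of_line (H.line_symm _ _ h)

/-- The middle node of the triple is in `C` if and only if it is a collider. -/
def Open (H : LooplessMixedGraph V) (C : Set V) (y b x : V) : Prop :=
  (H.HeadTo y b ∧ H.HeadTo x b) ↔ b ∈ C

theorem Open.symm {y b x : V} (h : H.Open C y b x) : H.Open C x b y := by
  unfold Open at *; tauto

theorem open_symm (H : LooplessMixedGraph V) (C : Set V) (y b x : V) (h : H.Open C y b x) :
    H.Open C x b y :=
  h.symm

theorem adj_symm (H : LooplessMixedGraph V) (u v : V) (h : H.Adj u v) : H.Adj v u :=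
  h.symm

/-- There is a walk between `a` and `c` whose inner nodes are in `C` if they are colliders and
outside `C` if not. -/
def Conn (H : LooplessMixedGraph V) (C : Set V) (a c : V) : Prop :=
  ∃ n y, HalfWalk H.Adj (H.Open C) a n y c

/-- Edge marks are determined by the endpoints, so walks may forget the kinds of their edges. -/
theorem EdgeKind.headAtEnd_iff (hH : H.IsRegressionChainGraph) {k : EdgeKind} {u v : V}
    (h : H.HasEdge k u v) : k.HeadAtEnd ↔ H.HeadTo u v := by
  cases k <;> simp only [HasEdge, HeadAtEnd, true_iff, false_iff] at *
  exacts [.inl h, hH.not_headTo_of_arrow h, .inr h, hH.not_headTo_of_line' h]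

theorem EdgeKind.headAtStart_iff (hH : H.IsRegressionChainGraph) {k : EdgeKind} {u v : V}
    (h : H.HasEdge k u v) : k.HeadAtStart ↔ H.HeadTo v u := by
  cases k <;> simp only [HasEdge, HeadAtStart, true_iff, false_iff] at *
  exacts [hH.not_headTo_of_arrow h, .inl h, .inr (H.arc_symm _ _ h), hH.not_headTo_of_line h]

theorem HasEdge.adj {k : EdgeKind} {u v : V} (h : H.HasEdge k u v) : H.Adj u v := by
  cases k
  exacts [.inl h, .inr (.inl h), .inr (.inr (.inl h)), .inr (.inr (.inr h))]

theorem Adj.exists_hasEdge {u v : V} (h : H.Adj u v) : ∃ k, H.HasEdge k u v := by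
  rcases h with h | h | h | h
  exacts [⟨.forward, h⟩, ⟨.backward, h⟩, ⟨.arc, h⟩, ⟨.line, h⟩]

/-- Follow the arrows to the first node in C, which is a collider because the walk turns round
there, and return the same way; the nodes passed in between are non-colliders outside C. -/
theorem _root_.HalfWalk.excursion (hH : H.IsRegressionChainGraph) {a b d c : V} {n : ℕ}
    (h : HalfWalk H.Adj (H.Open C) a n b d) (hbd : H.arrow b d)
    (hd : Relation.ReflTransGen H.arrow d c) (hc : c ∈ C) :
    ∃ m, HalfWalk H.Adj (H.Open C) a m d b := by
  induction hd using Relation.ReflTransGen.head_induction_on generalizing b n with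
  | refl =>
    exact ⟨_, h.step (.inr (.inl hbd)) (by simp [Open, HeadTo, hbd, hc])⟩
  | @head d e hde _ ih =>
    by_cases hdC : d ∈ C
    · exact ⟨_, h.step (.inr (.inl hbd)) (by simp [Open, HeadTo, hbd, hdC])⟩
    · have h1 : H.Open C b d e := by simp [Open, hdC, hH.not_headTo_of_arrow hde]
      obtain ⟨m, hm⟩ := ih (h.step (.inl hde) h1) hde
      exact ⟨_, hm.step (.inr (.inl hbd)) h1.symm⟩

theorem Walk.conn (hH : H.IsRegressionChainGraph) {x v : V} (p : H.Walk x v) {a y : V} {n : ℕ}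
    {k : EdgeKind} (hk : H.HasEdge k y x) (ha : HalfWalk H.Adj (H.Open C) a n y x)
    (hp : (Walk.cons k hk p).IsMConnecting C) : H.Conn C a v := by
  induction p generalizing y n k with
  | nil => exact ⟨_, _, ha⟩
  | @cons x x' v k' hk' p ih =>
    obtain ⟨h1, h2, h3⟩ := hp
    rw [EdgeKind.headAtEnd_iff hH hk, EdgeKind.headAtStart_iff hH hk'] at h1 h2
    by_cases hcol : H.HeadTo y x ∧ H.HeadTo x' x
    · by_cases hx : x ∈ C
      · exact ih hk' (ha.step hk'.adj (by simp [Open, hcol, hx])) h3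
      · obtain ⟨c, hc, hxc⟩ := (h1 hcol).resolve_left hx
        obtain ⟨d, hxd, hdc⟩ := Relation.TransGen.head'_iff.1 hxc
        have ho : ∀ z, H.Open C z x d := fun z => by
          simp [Open, hx, hH.not_headTo_of_arrow hxd]
        obtain ⟨m, hm⟩ := (ha.step (.inl hxd) (ho _)).excursion hH hxd hdc hc
        exact ih hk' (hm.step hk'.adj (ho _).symm) h3
    · exact ih hk' (ha.step hk'.adj (by simp [Open, hcol, h2 hcol])) h3

theorem _root_.HalfWalk.exists_walk (hH : H.IsRegressionChainGraph) {c b y : V} {n : ℕ}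
    (h : HalfWalk H.Adj (H.Open C) c n b y) :
    ∃ (k : EdgeKind) (hk : H.HasEdge k y b) (p : H.Walk b c),
      (Walk.cons k hk p).IsMConnecting C := by
  induction h with
  | single h =>
    obtain ⟨k, hk⟩ := h.symm.exists_hasEdge
    exact ⟨k, hk, .nil _, trivial⟩
  | step h hR hP ih =>
    obtain ⟨k, hk, p, hp⟩ := ih
    obtain ⟨k', hk'⟩ := hR.symm.exists_hasEdge
    refine ⟨k', hk', .cons k hk p, ?_, ?_, hp⟩
    all_goals
      rw [EdgeKind.headAtEnd_iff hH hk', EdgeKind.headAtStart_iff hH hk]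
      simp only [Open, Set.mem_union] at hP ⊢
      tauto

/-- The last clause: starting with an arrow, the walk either stays directed up to x or meets a first
collider, which lies in C or an(C) and makes w an ancestor of C. -/
theorem Walk.exists_cons_of_mem_support (hH : H.IsRegressionChainGraph) {u v : V}
    (q : H.Walk u v) {w x : V} {k : EdgeKind} (hk : H.HasEdge k w u)
    (hq : (Walk.cons k hk q).IsMConnecting C) (hx : x ∈ q.support) :
    ∃ (r : H.Walk x v) (w' : V) (k' : EdgeKind) (hk' : H.HasEdge k' w' x),
      r.support <:+ q.support ∧ (Walk.cons k' hk' r).IsMConnecting C ∧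
      (k = .forward → k' = .forward ∨ w ∈ H.an C) := by
  induction q generalizing w k with
  | nil u =>
    obtain rfl : x = u := by simpa [support] using hx
    exact ⟨.nil _, w, k, hk, List.suffix_rfl, trivial, .inl⟩
  | @cons u u' v k₁ hk₁ q ih =>
    by_cases hxu : x = u
    · subst hxu
      exact ⟨.cons k₁ hk₁ q, w, k, hk, List.suffix_rfl, hq, .inl⟩
    · obtain ⟨r, w', k', hk', hs, hr, hf⟩ :=
        ih hk₁ hq.2.2 (by simpa [support, hxu] using hx)
      refine ⟨r, w', k', hk', hs.trans (List.suffix_cons _ _), hr, ?_⟩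
      rintro rfl
      have han : u ∈ C ∪ H.an C → w ∈ H.an C := by
        rintro (hu | ⟨c, hc, hu⟩)
        · exact ⟨u, hu, .single hk⟩
        · exact ⟨c, hc, .head hk hu⟩
      cases k₁ with
      | forward => exact (hf rfl).imp_right fun h => han (.inr h)
      | backward => exact .inr (han (hq.1 ⟨trivial, trivial⟩))
      | arc => exact .inr (han (hq.1 ⟨trivial, trivial⟩))
      | line => exact absurd (.inl hk) (hH.not_headTo_of_line hk₁)

theorem Walk.exists_isPath_cons (hH : H.IsRegressionChainGraph) {x v : V} (q : H.Walk x v)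
    {y : V} {k : EdgeKind} (hk : H.HasEdge k y x) (hq : (Walk.cons k hk q).IsMConnecting C) :
    ∃ q' : H.Walk x v, q'.IsPath ∧ (Walk.cons k hk q').IsMConnecting C := by
  induction q generalizing y k with
  | nil => exact ⟨.nil _, by simp [IsPath, support], trivial⟩
  | @cons x x₁ v k₁ hk₁ q ih =>
    obtain ⟨q', hp, hm⟩ := ih hk₁ hq.2.2
    by_cases hx : x ∈ q'.support
    · obtain ⟨r, w', k', hk', hs, hr, hf⟩ := q'.exists_cons_of_mem_support hH hk₁ hm hx
      refine ⟨r, hp.sublist hs.sublist, ?_⟩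
      cases r with
      | nil => trivial
      | cons k₂ hk₂ r =>
        obtain ⟨h1, h2, -⟩ := hq
        obtain ⟨h3, h4, h5⟩ := hr
        -- The new triple at x joins the first edge of one old triple to the second edge of another.
        -- If it is a collider while neither old one is, x is left by an arrow and re-entered
        -- without an arrowhead, so x is an ancestor of C.
        refine ⟨fun hc => ?_, fun hc => ?_, h5⟩
        · by_cases hk₁s : k₁.HeadAtStart
          · exact h1 ⟨hc.1, hk₁s⟩
          by_cases hk'e : k'.HeadAtEnd
          · exact h3 ⟨hk'e, hc.2⟩
          cases k₁ with
          | forward =>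
            rcases hf rfl with rfl | h
            · exact absurd trivial hk'e
            · exact .inr h
          | backward => exact absurd trivial hk₁s
          | arc => exact absurd trivial hk₁s
          | line =>
            exact absurd ((EdgeKind.headAtEnd_iff hH hk).1 hc.1) (hH.not_headTo_of_line hk₁)
        · by_cases hke : k.HeadAtEnd
          · exact h4 fun h => hc ⟨hke, h.2⟩
          · exact h2 fun h => hke h.1
    · exact ⟨.cons k₁ hk₁ q', List.nodup_cons.2 ⟨hx, hp⟩, hq.1, hq.2.1, hm⟩

theorem Conn.exists_isPath (hH : H.IsRegressionChainGraph) {a c : V} (hac : a ≠ c)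
    (h : H.Conn C a c) : ∃ p : H.Walk a c, p.IsPath ∧ p.IsMConnecting C := by
  obtain ⟨n, y, h⟩ := h
  obtain ⟨z, h⟩ := h.reverse (H.open_symm C) H.adj_symm
  obtain ⟨k, hk, p, hp⟩ := HalfWalk.exists_walk hH h
  obtain ⟨q, hq, hm⟩ := p.exists_isPath_cons hH hk hp
  by_cases ha : a ∈ q.support
  · obtain ⟨r, w', k', hk', hs, hr, -⟩ := q.exists_cons_of_mem_support hH hk hm ha
    refine ⟨r, hq.sublist hs.sublist, ?_⟩
    cases r with
    | nil => trivial
    | cons k₂ hk₂ r => exact hr.2.2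
  · exact ⟨.cons k hk q, List.nodup_cons.2 ⟨ha, hq⟩, hm⟩

theorem mSep_iff (hH : H.IsRegressionChainGraph) {A B : Set V} (hAB : Disjoint A B) :
    H.MSep A B C ↔ ∀ a ∈ A, ∀ b ∈ B, ¬ H.Conn C a b := by
  constructor
  · intro h a ha b hb hc
    obtain ⟨p, hp, hm⟩ := hc.exists_isPath hH (hAB.ne_of_mem ha hb)
    exact h a ha b hb p hp hm
  · intro h a ha b hb p _ hm
    cases p with
    | nil => exact hAB.ne_of_mem ha hb rfl
    | cons k hk p => exact h a ha b hb (p.conn hH hk (.single hk.adj) hm)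

theorem IsDAG.isRegressionChainGraph (hG : G.IsDAG) : G.IsRegressionChainGraph where
  no_head_to_line _ _ _ _ h := hG.no_line _ _ h
  no_cycle i _ h h' := hG.acyclic i <| .head' h <| Relation.ReflTransGen.mono (fun _ _ h =>
    h.resolve_right (hG.no_arc _ _)) _ _ h'

/-! ### Separation of non-adjacent nodes. -/

/-- The nodes from which one gets to `a` or `c` along lines and arrows. -/
def anterior (H : LooplessMixedGraph V) (a c : V) : Set V :=
  {x | Relation.ReflTransGen (fun u v => H.arrow u v ∨ H.line u v) x a ∨
    Relation.ReflTransGen (fun u v => H.arrow u v ∨ H.line u v) x c}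

theorem mem_anterior_of_step {a c u v : V} (h : H.arrow u v ∨ H.line u v)
    (hv : v ∈ H.anterior a c) : u ∈ H.anterior a c :=
  hv.imp (.head h) (.head h)

/-- Every node reached has an arrowhead pointing to it, so no line can follow. -/
theorem IsRegressionChainGraph.reflTransGen_arrow (hH : H.IsRegressionChainGraph) {z b t : V}
    (hz : H.HeadTo z b)
    (h : Relation.ReflTransGen (fun u v => H.arrow u v ∨ H.line u v) b t) :
    Relation.ReflTransGen H.arrow b t := by
  suffices Relation.ReflTransGen H.arrow b t ∧ ∃ z, H.HeadTo z t from this.1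
  induction h with
  | refl => exact ⟨.refl, z, hz⟩
  | tail _ h ih =>
    obtain ⟨ih, w, hw⟩ := ih
    rcases h with h | h
    · exact ⟨ih.tail h, _, .inl h⟩
    · exact absurd hw (hH.not_headTo_of_line h)

theorem IsRegressionChainGraph.false_of_headTo_anterior (hH : H.IsRegressionChainGraph)
    {a b c : V} (hb : b ∈ H.anterior a c) (hba : b ≠ a) (hbc : b ≠ c)
    (ha : Relation.ReflTransGen H.HeadTo a b) (hc : H.HeadTo c b) : False := by
  have key : ∀ t, b ≠ t → Relation.ReflTransGen H.arrow b t →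
      Relation.ReflTransGen H.HeadTo t b → False := by
    intro t hbt hr ht
    rcases hr.cases_head with h | ⟨d, hd, hdt⟩
    · exact hbt h
    · exact hH.no_cycle _ _ hd
        ((Relation.ReflTransGen.mono (fun _ _ h => Or.inl h) _ _ hdt).trans ht)
  rcases hb with h | h
  · exact key a hba (hH.reflTransGen_arrow hc h) ha
  · exact key c hbc (hH.reflTransGen_arrow hc h) (.single hc)

/-- Regression chain graphs are maximal: non-adjacent nodes can be separated. -/
theorem IsRegressionChainGraph.exists_not_conn (hH : H.IsRegressionChainGraph) {a c : V}
    (hac : a ≠ c) (hadj : ¬ H.Adj a c) : ∃ C : Set V, a ∉ C ∧ c ∉ C ∧ ¬ H.Conn C a c := by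
  set U := H.anterior a c with hU
  have haU : a ∈ U := .inl .refl
  have hcU : c ∈ U := .inr .refl
  refine ⟨U \ {a, c}, by simp, by simp, ?_⟩
  set C := U \ {a, c} with hC
  have start : ∀ x, H.Adj a x →
      (x ∉ U ∧ H.HeadTo a x) ∨ (x ∈ C ∧ (H.HeadTo a x → Relation.ReflTransGen H.HeadTo a x)) := by
    intro x hx
    by_cases hxU : x ∈ U
    · refine .inr ⟨⟨hxU, ?_⟩, fun h => .single h⟩
      rintro (rfl | rfl)
      exacts [not_adj_self _ hx, hadj hx]
    · refine .inl ⟨hxU, ?_⟩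
      rcases hx.cases with h | h | h
      · exact h
      · exact absurd (mem_anterior_of_step (.inl h) haU) hxU
      · exact absurd (mem_anterior_of_step (.inr (H.line_symm _ _ h)) haU) hxU
  -- Outside U the walk can continue only along arrows and never re-enters U. Inside C every node is
  -- a collider; a step from there to c would close a cycle through an arrow. Hence c is never
  -- reached.
  have key : ∀ n y b, HalfWalk H.Adj (H.Open C) a n y b → (b ∉ U ∧ H.HeadTo y b) ∨ b = a ∨
      (b ∈ C ∧ (H.HeadTo y b → Relation.ReflTransGen H.HeadTo a b)) := by
    intro n y b h
    induction h with
    | single h => exact (start _ h).imp_right .inr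
    | @step n y b x h hR hP ih =>
      rcases ih with ⟨hbU, hyb⟩ | rfl | ⟨hbC, hyb⟩
      · have hxb : ¬ H.HeadTo x b := fun hx => hbU (hP.1 ⟨hyb, hx⟩).1
        refine .inl ⟨fun hx => ?_, ?_⟩
        · rcases hR.symm.cases with h | h | h
          · exact hxb h
          · exact hbU (mem_anterior_of_step (.inl h) hx)
          · exact hH.not_headTo_of_line' h hyb
        · rcases hR.cases with h | h | h
          · exact h
          · exact absurd (.inl h) hxb
          · exact absurd hyb (hH.not_headTo_of_line h)
      · exact (start _ hR).imp_right .inr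
      · obtain ⟨hyb', hxb⟩ := hP.2 hbC
        have hb2 := hbC.2
        simp only [Set.mem_insert_iff, Set.mem_singleton_iff, not_or] at hb2
        have hxc : x ≠ c := by
          rintro rfl
          exact hH.false_of_headTo_anterior hbC.1 hb2.1 hb2.2 (hyb hyb') hxb
        by_cases hxa : x = a
        · exact .inr (.inl hxa)
        by_cases hxU : x ∈ U
        · refine .inr (.inr ⟨⟨hxU, by simp [hxa, hxc]⟩, fun h => (hyb hyb').tail h⟩)
        · refine .inl ⟨hxU, ?_⟩
          rcases hxb with h | h
          · exact absurd (mem_anterior_of_step (.inl h) hbC.1) hxU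
          · exact .inr (H.arc_symm _ _ h)
  rintro ⟨n, y, h⟩
  rcases key n y c h with h | h | h
  · exact h.1 hcU
  · exact hac h.symm
  · exact h.1.2 (by simp)

/-! ### Invariants of Markov equivalence; necessity of the conditions. -/

theorem markovEquivalent_of_conn (hH : H.IsRegressionChainGraph) (hG : G.IsRegressionChainGraph)
    (h : ∀ (C : Set V) (a c : V), a ≠ c → (H.Conn C a c ↔ G.Conn C a c)) :
    H.MarkovEquivalent G := by
  intro A B C hAB _ _
  rw [mSep_iff hH hAB, mSep_iff hG hAB]
  exact forall₄_congr fun a ha b hb => not_congr (h C a b (hAB.ne_of_mem ha hb))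

theorem MarkovEquivalent.conn_iff (hH : H.IsRegressionChainGraph) (hG : G.IsRegressionChainGraph)
    (h : H.MarkovEquivalent G) {a c : V} (hac : a ≠ c) (ha : a ∉ C) (hc : c ∉ C) :
    H.Conn C a c ↔ G.Conn C a c := by
  have := h {a} {c} C (by simpa using hac) (by simpa using ha) (by simpa using hc)
  rw [mSep_iff hH (by simpa using hac), mSep_iff hG (by simpa using hac)] at this
  simpa using this.not

theorem MarkovEquivalent.adj_of_adj (hH : H.IsRegressionChainGraph)
    (hG : G.IsRegressionChainGraph) (h : H.MarkovEquivalent G) {a c : V} (hac : H.Adj a c) :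
    G.Adj a c := by
  by_contra hn
  have hne : a ≠ c := by
    rintro rfl
    exact not_adj_self _ hac
  obtain ⟨C, ha, hc, hC⟩ := hG.exists_not_conn hne hn
  exact hC ((h.conn_iff hH hG hne ha hc).1 ⟨_, _, .single hac⟩)

/-- Markov equivalent regression chain graphs have the same unshielded colliders. -/
theorem MarkovEquivalent.collider_iff (hH : H.IsRegressionChainGraph)
    (hG : G.IsRegressionChainGraph) (h : H.MarkovEquivalent G) {a b c : V} (hac : a ≠ c)
    (hn : ¬ H.Adj a c) (hab : H.Adj a b) (hbc : H.Adj b c) :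
    (H.HeadTo a b ∧ H.HeadTo c b) ↔ (G.HeadTo a b ∧ G.HeadTo c b) := by
  obtain ⟨C, ha, hc, hC⟩ := hH.exists_not_conn hac hn
  have hC' := mt (h.conn_iff hH hG hac ha hc).2 hC
  -- An open triple would connect a and c. So in both graphs b is a collider exactly if it is
  -- outside the common separating set.
  have h1 : ¬ H.Open C a b c := fun ho => hC ⟨_, _, (HalfWalk.single hab).step hbc ho⟩
  have h2 : ¬ G.Open C a b c := fun ho =>
    hC' ⟨_, _, (HalfWalk.single (h.adj_of_adj hH hG hab)).step (h.adj_of_adj hH hG hbc) ho⟩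
  unfold Open at h1 h2
  tauto

theorem IsDAG.not_headTo (hG : G.IsDAG) {u v : V} (h : G.HeadTo u v) : ¬ G.HeadTo v u := by
  rcases h with h | h
  · exact hG.isRegressionChainGraph.not_headTo_of_arrow h
  · exact absurd h (hG.no_arc _ _)

theorem IsDAG.arrow_or_arrow (hG : G.IsDAG) {u v : V} (h : G.Adj u v) :
    G.arrow u v ∨ G.arrow v u := by
  rcases h with h | h | h | h
  exacts [.inl h, .inr h, absurd h (hG.no_arc _ _), absurd h (hG.no_line _ _)]

theorem MarkovEquivalent.false_of_colliderPath (hH : H.IsRegressionChainGraph)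
    (hG : G.IsDAG) (h : H.MarkovEquivalent G) {a b c d : V} (hp : H.IsColliderPathFour a b c d)
    (hac : ¬ H.Adj a c) (hbd : ¬ H.Adj b d) : False := by
  obtain ⟨hnd, hab, hbc, hdc⟩ := hp
  have hne : a ≠ c ∧ b ≠ d := by
    simp only [List.nodup_cons, List.mem_cons] at hnd
    tauto
  have hG' := hG.isRegressionChainGraph
  have hcb : H.HeadTo c b := .inr (H.arc_symm _ _ hbc)
  have h1 := (h.collider_iff hH hG' hne.1 hac hab.adj hcb.adj.symm).1 ⟨hab, hcb⟩
  have h2 := (h.collider_iff hH hG' hne.2 hbd hcb.adj.symm hdc.adj.symm).1 ⟨.inr hbc, hdc⟩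
  exact hG.not_headTo h1.2 h2.1

theorem IsDAG.exists_sink [Finite V] (hG : G.IsDAG) {ι : Type*} [Nonempty ι] (f : ι → V) :
    ∃ i, ∀ j, ¬ G.arrow (f i) (f j) := by
  have : IsStrictOrder V (Relation.TransGen fun u v => G.arrow v u) :=
    { irrefl := fun v h => hG.acyclic v (by rwa [← Relation.transGen_swap] at h)
      trans := fun _ _ _ => Relation.TransGen.trans }
  have wf := Finite.wellFounded_of_trans_of_irrefl (Relation.TransGen fun u v => G.arrow v u)
  obtain ⟨_, ⟨i, rfl⟩, hi⟩ := wf.has_min (Set.range f) (Set.range_nonempty f)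
  exact ⟨i, fun j hj => hi (f j) ⟨j, rfl⟩ (.single hj)⟩

theorem MarkovEquivalent.isChordalGraph [Finite V] (hH : H.IsRegressionChainGraph)
    (hG : G.IsDAG) (h : H.MarkovEquivalent G) : H.lineSubgraph.IsChordalGraph := by
  intro n hn
  refine ⟨fun e => ?_⟩
  obtain ⟨n, rfl⟩ : ∃ m, n = m + 4 := ⟨n - 4, by omega⟩
  have hG' := hG.isRegressionChainGraph
  have hline : ∀ i j, H.line (e i) (e j) ↔ i - j = 1 ∨ j - i = 1 := fun i j =>
    (e.map_rel_iff (a := i) (b := j)).trans SimpleGraph.cycleGraph_adj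
  obtain ⟨i, hi⟩ := hG.exists_sink (fun i => e i)
  have hl1 : H.line (e (i + 1)) (e i) := (hline _ _).2 (.inl (by simp))
  have hl2 : H.line (e i) (e (i - 1)) := (hline _ _).2 (.inl (by simp))
  -- The two neighbours of the sink differ by 2; -2 = 1 would require a triangle.
  have h2 : ∀ k : Fin (n + 4), k = 1 + 1 → k ≠ 1 ∧ -k ≠ 1 := by
    rintro k rfl
    constructor
    · intro h; simp at h
    · intro h
      have := congrArg (fun x => (x + (1 + 1) : Fin (n + 4)).val) h
      simp [Fin.val_add] at this
      rw [Nat.mod_eq_of_lt (by omega)] at this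
      omega
  have hsub : (i + 1) - (i - 1) = (1 + 1 : Fin (n + 4)) := by abel
  have hn : ¬ H.line (e (i + 1)) (e (i - 1)) := by
    rw [hline, hsub, ← neg_sub, hsub]
    have := h2 _ rfl
    tauto
  have hne : e (i + 1) ≠ e (i - 1) := by
    intro h
    have := e.injective h
    rw [← sub_eq_zero, hsub] at this
    simp [Fin.ext_iff, Fin.val_add] at this
    rw [Nat.mod_eq_of_lt (by omega)] at this
    omega
  have hna : ¬ H.Adj (e (i + 1)) (e (i - 1)) := by
    rintro (h | h | h | h)
    · exact hH.not_headTo_of_line' hl2 (.inl h)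
    · exact hH.not_headTo_of_line hl1 (.inl h)
    · exact hH.not_headTo_of_line' hl2 (.inr h)
    · exact hn h
  have ha : ∀ {u}, H.line (e u) (e i) → G.HeadTo (e u) (e i) := fun hu =>
    .inl ((hG.arrow_or_arrow (h.adj_of_adj hH hG' (.inr (.inr (.inr hu))))).resolve_right (hi _))
  have := (h.collider_iff hH hG' hne hna (.inr (.inr (.inr hl1))) (.inr (.inr (.inr hl2)))).2
    ⟨ha hl1, ha (H.line_symm _ _ hl2)⟩
  exact hH.not_headTo_of_line hl2 this.1

end LooplessMixedGraph

/-! ### Chordal graphs: simplicial nodes and perfect elimination orders. -/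

namespace SimpleGraph

variable {V : Type*} {G : SimpleGraph V}

/-- A shortest walk has no chords. -/
theorem Walk.eq_add_one_of_adj_getVert {s t : V} (p : G.Walk s t) (hp : p.length = G.dist s t)
    {i j : ℕ} (hij : i < j) (hj : j ≤ p.length) (h : G.Adj (p.getVert i) (p.getVert j)) :
    j = i + 1 := by
  by_contra hne
  have := dist_le ((p.take i).append (Walk.cons h (p.drop j)))
  simp only [length_append, length_cons, take_length, drop_length] at this
  omega

theorem Walk.getVert_ne {s t : V} (p : G.Walk s t) (hp : p.length = G.dist s t)
    {i j : ℕ} (hij : i < j) (hj : j ≤ p.length) : p.getVert i ≠ p.getVert j := by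
  intro h
  have := dist_le ((p.take i).append ((p.drop j).copy h.symm rfl))
  simp only [length_append, length_copy, take_length, drop_length] at this
  omega

/-- Two neighbours of `v` that are joined by a walk whose inner nodes are not neighbours of `v`
are adjacent in a chordal graph. -/
theorem IsChordalGraph.adj_of_reachable (hG : G.IsChordalGraph) {G' : SimpleGraph V} {v s t : V}
    (hG' : ∀ x y, G'.Adj x y → (G.Adj x y ∧ x ≠ v) ∧ (G.Adj v x → x = s ∨ x = t))
    (hind : ∀ x y z w, G'.Adj x y → G'.Adj z w → G.Adj x z → G'.Adj x z)
    (hs : G.Adj v s) (ht : G.Adj v t) (hst : s ≠ t) (hr : G'.Reachable s t) : G.Adj s t := by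
  by_contra hn
  obtain ⟨p, hp⟩ := hr.exists_walk_length_eq_dist
  have h0 : p.length ≠ 0 := fun h => hst (Walk.eq_of_length_eq_zero h)
  have h1 : p.length ≠ 1 := fun h => hn (hG' _ _ (Walk.adj_of_length_eq_one h)).1.1
  have hadj : ∀ i ≤ p.length, ∃ y, G'.Adj (p.getVert i) y := by
    intro i hi
    rcases hi.lt_or_eq with hi | rfl
    · exact ⟨_, p.adj_getVert_succ hi⟩
    · have := p.adj_getVert_succ (i := p.length - 1) (by omega)
      rw [Nat.sub_add_cancel (by omega)] at this
      exact ⟨_, this.symm⟩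
  have hchord : ∀ i j, i < j → j ≤ p.length →
      (G.Adj (p.getVert i) (p.getVert j) ↔ j = i + 1) := by
    intro i j hij hj
    constructor
    · intro h
      obtain ⟨y, hy⟩ := hadj i (by omega)
      obtain ⟨z, hz⟩ := hadj j hj
      exact p.eq_add_one_of_adj_getVert hp hij hj (hind _ _ _ _ hy hz h)
    · rintro rfl
      exact (hG' _ _ (p.adj_getVert_succ hj)).1.1
  have hv : ∀ i ≤ p.length, (G.Adj v (p.getVert i) ↔ i = 0 ∨ i = p.length) := by
    intro i hi
    constructor
    · intro h
      obtain ⟨y, hy⟩ := hadj i hi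
      by_contra! hne
      rcases (hG' _ _ hy).2 h with h | h
      · exact p.getVert_ne hp (i := 0) (j := i) (by omega) hi (by simp [h])
      · exact p.getVert_ne hp (i := i) (j := p.length) (by omega) le_rfl (by simp [h])
    · rintro (rfl | rfl)
      · simpa using hs
      · simpa using ht
  -- The shortest walk closed up through v, which gets the last index; this is a chordless cycle.
  let f : Fin (p.length + 2) → V := fun i => if i.1 ≤ p.length then p.getVert i.1 else v
  have hf : ∀ i j : Fin (p.length + 2), i < j →
      f i ≠ f j ∧ (G.Adj (f i) (f j) ↔ (cycleGraph (p.length + 2)).Adj i j) := by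
    intro i j hij
    have hij' : i.1 < j.1 := hij
    have hj' := j.2
    have hc : (cycleGraph (p.length + 2)).Adj i j ↔
        j.1 = i.1 + 1 ∨ (i.1 = 0 ∧ j.1 = p.length + 1) := by
      rw [cycleGraph_adj', Fin.coe_sub_iff_le.2 hij.le, Fin.coe_sub_iff_lt.2 hij]
      omega
    have hi : i.1 ≤ p.length := by omega
    rw [hc]
    by_cases hj : j.1 ≤ p.length
    · simp only [f, hi, hj, if_true]
      refine ⟨p.getVert_ne hp hij' hj, ?_⟩
      rw [hchord _ _ hij' hj]
      omega
    · simp only [f, hi, hj, if_true, if_false]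
      obtain ⟨y, hy⟩ := hadj i hi
      refine ⟨(hG' _ _ hy).1.2, ?_⟩
      rw [adj_comm, hv _ hi]
      omega
  refine (hG (p.length + 2) (by omega)).false ⟨⟨f, ?_⟩, ?_⟩
  · intro i j h
    rcases lt_trichotomy i j with hij | hij | hij
    · exact absurd h (hf i j hij).1
    · exact hij
    · exact absurd h.symm (hf j i hij).1
  · intro i j
    rcases lt_trichotomy i j with hij | rfl | hij
    · exact (hf i j hij).2
    · simp
    · rw [adj_comm, (cycleGraph _).adj_comm]
      exact (hf j i hij).2

/-- Dirac's lemma: every node of `U` that is not adjacent to all others has a non-neighbour that is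
simplicial in `U`. -/
theorem IsChordalGraph.exists_simplicial_not_adj (hG : G.IsChordalGraph) (U : Finset V) (v w : V)
    (hv : v ∈ U) (hw : w ∈ U) (hvw : v ≠ w) (hn : ¬ G.Adj v w) :
    ∃ x ∈ U, x ≠ v ∧ ¬ G.Adj v x ∧
      ∀ y ∈ U, ∀ z ∈ U, G.Adj x y → G.Adj x z → y ≠ z → G.Adj y z := by
  classical
  induction hU : U.card using Nat.strong_induction_on generalizing U v w with
  | _ n ih =>
  subst hU
  let W : V → Prop := fun x => x ∈ U ∧ x ≠ v ∧ ¬ G.Adj v x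
  -- K is the component of w among the non-neighbours of v, and S below is its boundary. S is a
  -- clique, since two of its nodes are joined through K away from v.
  let K : V → Prop := fun x => Relation.ReflTransGen (fun x y => G.Adj x y ∧ W y) w x
  have hKW : ∀ x, K x → W x := by
    intro x hx
    rcases hx.cases_tail with rfl | ⟨y, -, hy⟩
    · exact ⟨hw, hvw.symm, hn⟩
    · exact hy.2
  have hKs : ∀ x y, K x → G.Adj x y → W y → K y := fun x y hx hxy hy => hx.tail ⟨hxy, hy⟩
  let S : V → Prop := fun s => s ∈ U ∧ G.Adj v s ∧ ∃ k, K k ∧ G.Adj s k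
  have hSclique : ∀ s t, S s → S t → s ≠ t → G.Adj s t := by
    rintro s t ⟨hsU, hvs, k, hk, hsk⟩ ⟨htU, hvt, l, hl, htl⟩ hst
    let X : V → Prop := fun x => K x ∨ x = s ∨ x = t
    let G' : SimpleGraph V :=
      { Adj := fun x y => G.Adj x y ∧ X x ∧ X y
        symm := ⟨fun x y h => ⟨h.1.symm, h.2.2, h.2.1⟩⟩
        loopless := ⟨fun x h => h.1.ne rfl⟩ }
    have hwK : ∀ x, K x → G'.Reachable w x := by
      intro x hx
      induction hx with
      | refl => exact .refl _
      | tail h h' ih =>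
        exact ih.trans (Adj.reachable (G := G') ⟨h'.1, .inl h, .inl (h.tail h')⟩)
    refine hG.adj_of_reachable (G' := G') (v := v) ?_ ?_ hvs hvt hst ?_
    · rintro x y ⟨hxy, hx, -⟩
      refine ⟨⟨hxy, ?_⟩, fun hvx => ?_⟩
      · rcases hx with h | rfl | rfl
        exacts [(hKW _ h).2.1, hvs.ne', hvt.ne']
      · exact hx.resolve_left fun h => (hKW _ h).2.2 hvx
    · exact fun x y z w h h' hxz => ⟨hxz, h.2.1, h'.2.1⟩
    · exact (Adj.reachable (G := G') ⟨hsk, .inr (.inl rfl), .inl hk⟩).trans <|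
        (hwK k hk).symm.trans <| (hwK l hl).trans
        (Adj.reachable (G := G') ⟨htl.symm, .inl hl, .inr (.inr rfl)⟩)
  let U' := U.filter fun x => K x ∨ S x
  have hlt : U'.card < U.card := by
    refine Finset.card_lt_card ((Finset.ssubset_iff_of_subset (Finset.filter_subset _ _)).2
      ⟨v, hv, ?_⟩)
    simp only [Finset.mem_filter, not_and_or, not_or]
    exact .inr ⟨fun h => (hKW _ h).2.1 rfl, fun h => h.2.1.ne rfl⟩
  have hUK : ∀ x, K x → x ∈ U' := fun x hx => Finset.mem_filter.2 ⟨(hKW _ hx).1, .inl hx⟩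
  have hKN : ∀ x y, K x → y ∈ U → G.Adj x y → y ∈ U' := by
    intro x y hx hy hxy
    refine Finset.mem_filter.2 ⟨hy, ?_⟩
    by_cases hvy : G.Adj v y
    · exact .inr ⟨hy, hvy, x, hx, hxy.symm⟩
    · refine .inl (hKs x y hx hxy ⟨hy, ?_, hvy⟩)
      rintro rfl
      exact (hKW _ hx).2.2 hxy.symm
  -- Induction on K ∪ S yields a simplicial node avoiding a chosen node. That node is taken in S if
  -- possible, otherwise in K; either way the result cannot lie in S. If no choice exists, K ∪ S is
  -- complete.
  obtain ⟨x, hx, hsimp⟩ : ∃ x, K x ∧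
      ∀ y ∈ U', ∀ z ∈ U', G.Adj x y → G.Adj x z → y ≠ z → G.Adj y z := by
    by_cases hS : ∃ s, S s ∧ ∃ u ∈ U', s ≠ u ∧ ¬ G.Adj s u
    · obtain ⟨s, hs, u, hu, hsu, hnsu⟩ := hS
      obtain ⟨x, hx, hxs, hnx, hsimp⟩ := ih _ hlt U' s u
        (Finset.mem_filter.2 ⟨hs.1, .inr hs⟩) hu hsu hnsu rfl
      refine ⟨x, (Finset.mem_filter.1 hx).2.resolve_right fun h => ?_, hsimp⟩
      exact hnx (hSclique _ _ hs h hxs.symm)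
    · push Not at hS
      by_cases hK : ∃ k, K k ∧ ∃ u ∈ U', k ≠ u ∧ ¬ G.Adj k u
      · obtain ⟨k, hk, u, hu, hku, hnku⟩ := hK
        obtain ⟨x, hx, hxk, hnx, hsimp⟩ := ih _ hlt U' k u (hUK k hk) hu hku hnku rfl
        refine ⟨x, (Finset.mem_filter.1 hx).2.resolve_right fun h => ?_, hsimp⟩
        exact hnx (hS x h k (hUK k hk) hxk).symm
      · push Not at hK
        refine ⟨w, .refl, fun y hy z hz _ _ hyz => ?_⟩
        rcases (Finset.mem_filter.1 hy).2 with h | h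
        · exact hK y h z hz hyz
        · exact hS y h z hz hyz
  obtain ⟨hxU, hxv, hnx⟩ := hKW x hx
  exact ⟨x, hxU, hxv, hnx, fun y hy z hz hxy hxz =>
    hsimp y (hKN x y hx hy hxy) z (hKN x z hx hz hxz) hxy hxz⟩

theorem IsChordalGraph.exists_simplicial (hG : G.IsChordalGraph) (U : Finset V)
    (hU : U.Nonempty) :
    ∃ x ∈ U, ∀ y ∈ U, ∀ z ∈ U, G.Adj x y → G.Adj x z → y ≠ z → G.Adj y z := by
  by_cases h : ∃ v ∈ U, ∃ w ∈ U, v ≠ w ∧ ¬ G.Adj v w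
  · obtain ⟨v, hv, w, hw, hvw, hn⟩ := h
    obtain ⟨x, hx, -, -, hs⟩ := hG.exists_simplicial_not_adj U v w hv hw hvw hn
    exact ⟨x, hx, hs⟩
  · push Not at h
    obtain ⟨x, hx⟩ := hU
    exact ⟨x, hx, fun y hy z hz _ _ hyz => h y hy z hz hyz⟩

/-- A finite chordal graph has a perfect elimination order. -/
theorem IsChordalGraph.exists_elimination_order [Finite V] (hG : G.IsChordalGraph) :
    ∃ r : V → ℕ, Function.Injective r ∧
      ∀ u v w, G.Adj u w → G.Adj v w → u ≠ v → r u < r w → r v < r w → G.Adj u v := by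
  classical
  have := Fintype.ofFinite V
  suffices ∀ n, ∀ U : Finset V, U.card = n → ∃ r : V → ℕ, Set.InjOn r U ∧ (∀ u ∈ U, r u < n) ∧
      ∀ u ∈ U, ∀ v ∈ U, ∀ w ∈ U, G.Adj u w → G.Adj v w → u ≠ v → r u < r w → r v < r w →
        G.Adj u v by
    obtain ⟨r, hr, -, h⟩ := this _ Finset.univ rfl
    exact ⟨r, fun x y => hr (by simp) (by simp), fun u v w => h u (by simp) v (by simp) w (by simp)⟩
  intro n
  induction n with
  | zero =>
    intro U hU
    rw [Finset.card_eq_zero] at hU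
    subst hU
    exact ⟨fun _ => 0, by simp⟩
  | succ n ih =>
    intro U hU
    obtain ⟨x, hx, hs⟩ := hG.exists_simplicial U (Finset.card_pos.1 (by omega))
    obtain ⟨r, hinj, hlt, hr⟩ := ih (U.erase x) (by rw [Finset.card_erase_of_mem hx]; omega)
    have hlt' : ∀ u ∈ U, u ≠ x → r u < n := fun u hu hux => hlt u (Finset.mem_erase.2 ⟨hux, hu⟩)
    -- The simplicial node gets the highest rank: all its neighbours precede it.
    refine ⟨Function.update r x n, ?_, ?_, ?_⟩
    · intro u hu v hv huv
      by_cases hux : u = x <;> by_cases hvx : v = x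
      · rw [hux, hvx]
      · have := hlt' v hv hvx
        rw [hux, Function.update_self, Function.update_of_ne hvx] at huv
        omega
      · have := hlt' u hu hux
        rw [hvx, Function.update_self, Function.update_of_ne hux] at huv
        omega
      · rw [Function.update_of_ne hvx, Function.update_of_ne hux] at huv
        exact hinj (by simp [hux, Finset.mem_coe.1 hu]) (by simp [hvx, Finset.mem_coe.1 hv]) huv
    · intro u hu
      by_cases hux : u = x
      · simp [hux]
      · have := hlt' u hu hux
        rw [Function.update_of_ne hux]
        omega
    · intro u hu v hv w hw huw hvw huv hru hrv
      by_cases hwx : w = x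
      · subst hwx
        exact hs u hu v hv huw.symm hvw.symm huv
      · have hw' := hlt' w hw hwx
        rw [Function.update_of_ne hwx] at hru hrv
        have hux : u ≠ x := by
          rintro rfl
          rw [Function.update_self] at hru
          omega
        have hvx : v ≠ x := by
          rintro rfl
          rw [Function.update_self] at hrv
          omega
        rw [Function.update_of_ne hux] at hru
        rw [Function.update_of_ne hvx] at hrv
        exact hr u (by simp [hux, hu]) v (by simp [hvx, hv]) w (by simp [hwx, hw]) huw hvw huv hru hrv

end SimpleGraph

/-! ### Orientation along a perfect ranking preserves m-separation. -/

namespace LooplessMixedGraph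

variable {V : Type*} {H G : LooplessMixedGraph V} {C : Set V} {α : Type*} [LinearOrder α]

/-- A ranking of the nodes along which the edges of a graph can be oriented without changing the
unshielded colliders. -/
structure IsPerfectRanking (H : LooplessMixedGraph V) (r : V → α) : Prop where
  injective : Function.Injective r
  arrow_lt : ∀ u v, H.arrow u v → r u < r v
  arc : ∀ u v, H.arc u v → r u < r v → ∀ x, x ≠ v →
    (H.arrow x u → H.arrow x v) ∧ (H.arc x u → H.arc x v)
  line : ∀ u v w, H.line u w → H.line v w → u ≠ v → r u < r w → r v < r w → H.line u v

/-- Turn all edges into arrows that point to the node of higher rank. -/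
def orient (H : LooplessMixedGraph V) (r : V → α) : LooplessMixedGraph V where
  arrow u v := H.Adj u v ∧ r u < r v
  arc _ _ := False
  line _ _ := False
  arc_symm _ _ h := h
  line_symm _ _ h := h
  arrow_irrefl _ h := h.2.false
  arc_irrefl _ h := h
  line_irrefl _ h := h

theorem isDAG_orient (H : LooplessMixedGraph V) (r : V → α) : (H.orient r).IsDAG where
  no_arc _ _ h := h
  no_line _ _ h := h
  acyclic i h := by
    have : ∀ j, Relation.TransGen (H.orient r).arrow i j → r i < r j := fun j h => by
      induction h with
      | single h => exact h.2
      | tail _ h ih => exact ih.trans h.2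
    exact (this i h).false

theorem headTo_orient_iff {r : V → α} {u v : V} :
    (H.orient r).HeadTo u v ↔ H.Adj u v ∧ r u < r v :=
  ⟨fun h => h.resolve_right id, .inl⟩

theorem IsPerfectRanking.adj_orient_iff {r : V → α} (hr : H.IsPerfectRanking r) {u v : V} :
    (H.orient r).Adj u v ↔ H.Adj u v := by
  constructor
  · rintro (h | h | h | h)
    exacts [h.1, h.1.symm, h.elim, h.elim]
  · intro h
    have hne : u ≠ v := by
      rintro rfl
      exact not_adj_self _ h
    rcases lt_or_gt_of_ne (hr.injective.ne hne) with h' | h'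
    exacts [.inl ⟨h, h'⟩, .inr (.inl ⟨h.symm, h'⟩)]

theorem IsPerfectRanking.lt_or_lt {r : V → α} (hr : H.IsPerfectRanking r) {u v : V}
    (h : H.Adj u v) : r u < r v ∨ r v < r u := by
  refine lt_or_gt_of_ne (hr.injective.ne ?_)
  rintro rfl
  exact not_adj_self _ h

/-- A neighbour with an edge into `b` has such an edge into every node to which an arc from `b` is
oriented. -/
theorem IsPerfectRanking.headTo_of_arc (hH : H.IsRegressionChainGraph) {r : V → α}
    (hr : H.IsPerfectRanking r) {y b x : V} (hbx : H.arc b x) (hlt : r b < r x)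
    (hy : H.HeadTo y b) (hyx : y ≠ x) : H.HeadTo y x ∧ (H.HeadTo b y ↔ H.HeadTo x y) := by
  have h := hr.arc b x hbx hlt y hyx
  rcases hy with hy | hy
  · exact ⟨.inl (h.1 hy), by
      simp [hH.not_headTo_of_arrow hy, hH.not_headTo_of_arrow (h.1 hy)]⟩
  · exact ⟨.inr (h.2 hy), iff_of_true (.inr (H.arc_symm _ _ hy))
      (.inr (H.arc_symm _ _ (h.2 hy)))⟩

theorem IsPerfectRanking.arc_of_headTo {r : V → α} (hr : H.IsPerfectRanking r) {u v : V}
    (h : H.HeadTo u v) (hn : ¬ r u < r v) : H.arc u v :=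
  h.resolve_left fun h => hn (hr.arrow_lt _ _ h)

theorem IsPerfectRanking.line_of_lt {r : V → α} (hr : H.IsPerfectRanking r) {u v : V}
    (h : H.Adj u v) (hlt : r u < r v) (hn : ¬ H.HeadTo u v) : H.line u v := by
  rcases h.cases with h | h | h
  · exact absurd h hn
  · exact absurd hlt (hr.arrow_lt _ _ h).not_gt
  · exact h

theorem IsPerfectRanking.conn_orient (hH : H.IsRegressionChainGraph) {r : V → α}
    (hr : H.IsPerfectRanking r) {a c : V} (hac : a ≠ c) (h : H.Conn C a c) :
    (H.orient r).Conn C a c := by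
  have hadj : (H.orient r).Adj = H.Adj := by
    ext u v
    exact hr.adj_orient_iff
  obtain ⟨n, z, h⟩ := h
  unfold Conn
  rw [hadj]
  refine HalfWalk.exists_of_shorten (H.open_symm C) H.adj_symm ?_ h
  -- Here b is a collider and the arc to x is oriented away from it. If y ≠ x, then y is joined to x
  -- as it is to b, so leaving out b changes no marks at y or x.
  have short : ∀ (a c : V) (i j : ℕ) (y b x : V), a ≠ c → HalfWalk H.Adj (H.Open C) a i y b →
      HalfWalk H.Adj (H.Open C) c j x b → H.Open C y b x → b ∈ C → ¬ r x < r b →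
      ∃ k < i + j + 1, ∃ z, HalfWalk H.Adj (H.Open C) a k z c := by
    intro a c i j y b x hac h1 h2 hP hbC hx
    obtain ⟨hyb, hxb⟩ := hP.2 hbC
    have hbx := H.arc_symm _ _ (hr.arc_of_headTo hxb hx)
    have hlt := (hr.lt_or_lt h2.rel).resolve_left hx
    by_cases hyx : y = x
    · subst hyx
      refine HalfWalk.shortcut_back (H.open_symm C) H.adj_symm hac h1 h2 fun z w _ _ hz hw => ?_
      have : H.HeadTo b y := .inr hbx
      simp only [Open, this, and_true] at hz hw ⊢
      tauto
    · obtain ⟨hyx', hiff⟩ := hr.headTo_of_arc hH hbx hlt hyb hyx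
      refine HalfWalk.shortcut (H.open_symm C) H.adj_symm h1 h2 hyx'.adj (fun z _ hz => ?_)
        fun w _ hw => ?_
      · simpa only [Open, hiff] using hz
      · have : H.HeadTo b x := .inr hbx
        simpa only [Open, this, hyx'] using hw
  intro i j y b x h1 h2 hP hQ
  by_cases hbC : b ∈ C
  · by_cases hx : r x < r b
    · have hy : ¬ r y < r b := fun hy => hQ <| by
        simp [Open, headTo_orient_iff, h1.rel, h2.rel, hx, hy, hbC]
      obtain ⟨k, hk, z, hz⟩ := short c a j i x b y hac.symm h2 h1 hP.symm hbC hy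
      obtain ⟨z, hz⟩ := hz.reverse (H.open_symm C) H.adj_symm
      exact ⟨k, by omega, z, hz⟩
    · exact short a c i j y b x hac h1 h2 hP hbC hx
  · have hcol : ¬ (H.HeadTo y b ∧ H.HeadTo x b) := fun h => hbC (hP.1 h)
    obtain ⟨hy, hx⟩ : r y < r b ∧ r x < r b := by
      simp only [Open, headTo_orient_iff, h1.rel, h2.rel, hbC, true_and, iff_false,
        not_not] at hQ
      exact hQ
    -- A lower neighbour without arrowhead at b is joined by a line, and lines exclude any arrowhead
    -- at b.
    obtain ⟨hyl, hxl⟩ : H.line y b ∧ H.line x b := by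
      by_cases hyb : H.HeadTo y b
      · have hxl := hr.line_of_lt h2.rel hx fun hxb => hcol ⟨hyb, hxb⟩
        exact absurd hyb (hH.not_headTo_of_line' hxl)
      · have hyl := hr.line_of_lt h1.rel hy hyb
        exact ⟨hyl, hr.line_of_lt h2.rel hx (hH.not_headTo_of_line' hyl)⟩
    by_cases hyx : y = x
    · subst hyx
      refine HalfWalk.shortcut_back (H.open_symm C) H.adj_symm hac h1 h2 fun z w _ _ hz hw => ?_
      simpa only [Open, hH.not_headTo_of_line hyl, and_false] using hz
    · have hl := hr.line y x b hyl hxl hyx hy hx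
      refine HalfWalk.shortcut (H.open_symm C) H.adj_symm h1 h2 (.inr (.inr (.inr hl)))
        (fun z _ hz => ?_) fun w _ hw => ?_
      · simpa only [Open, hH.not_headTo_of_line hyl, and_false] using hz
      · simpa only [Open, hH.not_headTo_of_line hxl, and_false] using hw

/-- The condition `Open` for the oriented graph, relaxed at triples that are joined by lines. -/
def RelaxedOpen (H : LooplessMixedGraph V) (r : V → α) (C : Set V) (y b x : V) : Prop :=
  (H.line y b ∧ H.line x b ∧ (b ∈ C → r y < r b ∧ r x < r b)) ∨
    (¬ (H.line y b ∧ H.line x b) ∧ ((r y < r b ∧ r x < r b) ↔ b ∈ C))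

theorem relaxedOpen_symm (H : LooplessMixedGraph V) (r : V → α) (C : Set V) (y b x : V)
    (h : H.RelaxedOpen r C y b x) : H.RelaxedOpen r C x b y := by
  unfold RelaxedOpen at *
  tauto

theorem RelaxedOpen.iff_of_not_line {r : V → α} {y b x : V} (h : ¬ H.line x b) :
    H.RelaxedOpen r C y b x ↔ ((r y < r b ∧ r x < r b) ↔ b ∈ C) := by
  unfold RelaxedOpen
  tauto

/-- Leaving out a node between two lines can create an oriented collider outside C. If two lines
meet there it is harmless, being no collider in H; `RelaxedOpen` admits it, so that the shortening
can be iterated. -/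
theorem IsPerfectRanking.conn_of_conn_orient (hH : H.IsRegressionChainGraph) {r : V → α}
    (hr : H.IsPerfectRanking r) {a c : V} (hac : a ≠ c) (h : (H.orient r).Conn C a c) :
    H.Conn C a c := by
  have hadj : (H.orient r).Adj = H.Adj := by
    ext u v
    exact hr.adj_orient_iff
  have hPs := H.relaxedOpen_symm r C
  obtain ⟨n, z, h⟩ := h
  have hopen : ∀ y b x, (H.orient r).Open C y b x ∧ H.Adj y b ∧ H.Adj b x →
      H.RelaxedOpen r C y b x := by
    rintro y b x ⟨ho, hy, hx⟩
    simp only [Open, headTo_orient_iff, hy, hx.symm, true_and] at ho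
    unfold RelaxedOpen
    tauto
  rw [hadj] at h
  replace h : HalfWalk H.Adj (H.RelaxedOpen r C) a n z c := by
    clear hac
    induction h with
    | single h => exact .single h
    | step h hR hP ih => exact ih.step hR (hopen _ _ _ ⟨hP, h.rel, hR⟩)
  refine HalfWalk.exists_of_shorten hPs H.adj_symm ?_ h
  -- Leaving out b removes the oriented arrowhead at y, which matters only for y in C. Then y is
  -- either the start of the walk, where nothing is required, or its predecessor has a head into y
  -- and hence into x, and y is left out as well.
  have short₂ : ∀ (a c : V) (i j : ℕ) (y b x : V), HalfWalk H.Adj (H.RelaxedOpen r C) a i y b →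
      HalfWalk H.Adj (H.RelaxedOpen r C) c j x b → H.arc b x → r b < r y →
      r b < r x → r y < r x → H.arc y x →
      ∃ k < i + j + 1, ∃ z, HalfWalk H.Adj (H.RelaxedOpen r C) a k z c := by
    intro a c i j y b x h1 h2 hbx hby' hbx' hyx' hyx
    have hl : ∀ {w}, ¬ H.line w x := fun h => hH.not_headTo_of_line' h (.inr hyx)
    have hl' : ∀ {w}, ¬ H.line w y := fun h =>
      hH.not_headTo_of_line' h (.inr (H.arc_symm _ _ hyx))
    have hx : ∀ z w, r z < r x → H.RelaxedOpen r C w x b → H.RelaxedOpen r C w x z := by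
      intro z w hz hw
      rw [RelaxedOpen.iff_of_not_line hl] at hw ⊢
      simpa only [hz, hbx'] using hw
    by_cases hyC : y ∈ C
    · cases h1 with
      | single h =>
        exact ⟨_, by omega, HalfWalk.join hPs (.single (HeadTo.adj (.inr hyx)))
          (h2.replace_last (HeadTo.adj (.inr hyx)).symm fun w _ hw => hx a w hyx' hw) H.adj_symm⟩
      | @step i z _ _ h hR hP =>
        rw [RelaxedOpen.iff_of_not_line hl'] at hP
        have hzy := (hP.2 hyC).1
        have hzy' : H.HeadTo z y := by
          by_contra hn
          exact hl' (hr.line_of_lt h.rel hzy hn)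
        have hzx' := (hr.headTo_of_arc hH hyx hyx' hzy' (by
          rintro rfl
          exact hzy.not_gt hyx')).1
        refine ⟨_, by omega, HalfWalk.join hPs (h.replace_last hzx'.adj fun v _ hv => ?_)
          (h2.replace_last hzx'.adj.symm fun w _ hw => hx z w (hzy.trans hyx') hw) H.adj_symm⟩
        rw [RelaxedOpen.iff_of_not_line fun h => hl' (H.line_symm _ _ h)] at hv
        rw [RelaxedOpen.iff_of_not_line fun h => hl (H.line_symm _ _ h)]
        simpa only [hzy.not_gt, (hzy.trans hyx').not_gt] using hv
    · refine HalfWalk.shortcut hPs H.adj_symm h1 h2 (HeadTo.adj (.inr hyx)) (fun z _ hz => ?_)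
        fun w _ hw => hx y w hyx' hw
      rw [RelaxedOpen.iff_of_not_line hl'] at hz ⊢
      simp only [hby', hyC, hyx'.not_gt] at hz ⊢
      tauto
  have short₁ : ∀ (a c : V) (i j : ℕ) (y b x : V), a ≠ c →
      HalfWalk H.Adj (H.RelaxedOpen r C) a i y b → HalfWalk H.Adj (H.RelaxedOpen r C) c j x b →
      H.HeadTo y b → H.HeadTo x b → ¬ r x < r b →
      ∃ k < i + j + 1, ∃ z, HalfWalk H.Adj (H.RelaxedOpen r C) a k z c := by
    intro a c i j y b x hac h1 h2 hyb hxb hx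
    have hbx := H.arc_symm _ _ (hr.arc_of_headTo hxb hx)
    have hlt := (hr.lt_or_lt h2.rel).resolve_left hx
    have hlx : ∀ {w}, ¬ H.line x w := fun h => hH.not_headTo_of_line h (.inr hbx)
    have hlb : ∀ {w}, ¬ H.line b w := fun h => hH.not_headTo_of_line h hyb
    by_cases hyx : y = x
    · subst hyx
      refine HalfWalk.shortcut_back hPs H.adj_symm hac h1 h2 fun z w _ _ hz hw => ?_
      rw [RelaxedOpen.iff_of_not_line hlb] at hz hw
      rw [RelaxedOpen.iff_of_not_line fun h => hlx (H.line_symm _ _ h)]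
      simp only [hlt, and_true] at hz hw
      tauto
    obtain ⟨hyx', hiff⟩ := hr.headTo_of_arc hH hbx hlt hyb hyx
    rcases hr.lt_or_lt h1.rel with hy | hy
    · refine HalfWalk.shortcut hPs H.adj_symm h1 h2 hyx'.adj (fun z _ hz => ?_) fun w _ hw => ?_
      · rw [RelaxedOpen.iff_of_not_line hlb] at hz
        rw [RelaxedOpen.iff_of_not_line hlx]
        simpa only [hy.not_gt, (hy.trans hlt).not_gt] using hz
      · rw [RelaxedOpen.iff_of_not_line hlb] at hw
        rw [RelaxedOpen.iff_of_not_line fun h => hlx (H.line_symm _ _ h)]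
        simpa only [hlt, hy.trans hlt] using hw
    · have hby := H.arc_symm _ _ (hr.arc_of_headTo hyb hy.not_gt)
      have hyx'' : H.arc y x := (hr.arc b x hbx hlt y hyx).2 (H.arc_symm _ _ hby)
      rcases hr.lt_or_lt hyx'.adj with h | h
      · exact short₂ a c i j y b x h1 h2 hbx hy hlt h hyx''
      · obtain ⟨k, hk, z, hz⟩ :=
          short₂ c a j i x b y h2 h1 hby hlt hy h (H.arc_symm _ _ hyx'')
        obtain ⟨z, hz⟩ := hz.reverse hPs H.adj_symm
        exact ⟨k, by omega, z, hz⟩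
  intro i j y b x h1 h2 hP hQ
  by_cases hl : H.line y b ∧ H.line x b
  · obtain ⟨hyl, hxl⟩ := hl
    have hbC : b ∈ C := by
      by_contra hbC
      exact hQ (by simp [Open, hbC, hH.not_headTo_of_line' hyl])
    obtain ⟨hy, hx⟩ : r y < r b ∧ r x < r b := by
      unfold RelaxedOpen at hP
      tauto
    -- The orientation leaves y towards b, so y is an oriented non-collider.
    have hout : ∀ {z y}, H.Adj z y → H.line y b → r y < r b → H.RelaxedOpen r C z y b →
        y ∉ C ∧ (H.line z y ∨ ¬ r z < r y) := by
      intro z y hzy hyl hy hz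
      have h1 : y ∉ C := by
        intro hyC
        have := hy.not_gt
        unfold RelaxedOpen at hz
        tauto
      refine ⟨h1, ?_⟩
      by_contra! hn
      exact hn.1 (hr.line_of_lt hzy hn.2 (hH.not_headTo_of_line hyl))
    by_cases hyx : y = x
    · subst hyx
      refine HalfWalk.shortcut_back hPs H.adj_symm hac h1 h2 fun z w hzy hwy hz hw => ?_
      have hz' := hout hzy hyl hy hz
      have hw' := hout hwy hyl hy hw
      unfold RelaxedOpen
      tauto
    · have hline := hr.line y x b hyl hxl hyx hy hx
      have hline' := H.line_symm _ _ hline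
      refine HalfWalk.shortcut hPs H.adj_symm h1 h2 (.inr (.inr (.inr hline)))
        (fun z hzy hz => ?_) fun w hwx hw => ?_
      · have hz' := hout hzy hyl hy hz
        unfold RelaxedOpen
        tauto
      · have hw' := hout hwx hxl hx hw
        unfold RelaxedOpen
        tauto
  · have hP' : (r y < r b ∧ r x < r b) ↔ b ∈ C := (hP.resolve_left fun h => hl ⟨h.1, h.2.1⟩).2
    by_cases hbC : b ∈ C
    · obtain ⟨hy, hx⟩ := hP'.2 hbC
      refine absurd ?_ hl
      by_cases hyb : H.HeadTo y b
      · have hxl := hr.line_of_lt h2.rel hx fun hxb => hQ (by simp [Open, hbC, hyb, hxb])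
        exact absurd hyb (hH.not_headTo_of_line' hxl)
      · have hyl := hr.line_of_lt h1.rel hy hyb
        exact ⟨hyl, hr.line_of_lt h2.rel hx (hH.not_headTo_of_line' hyl)⟩
    · obtain ⟨hyb, hxb⟩ : H.HeadTo y b ∧ H.HeadTo x b := by
        by_contra h
        exact hQ ⟨fun h' => absurd h' h, fun h' => absurd h' hbC⟩
      by_cases hx : r x < r b
      · have hy : ¬ r y < r b := fun hy => hbC (hP'.1 ⟨hy, hx⟩)
        obtain ⟨k, hk, z, hz⟩ := short₁ c a j i x b y hac.symm h2 h1 hxb hyb hy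
        obtain ⟨z, hz⟩ := hz.reverse hPs H.adj_symm
        exact ⟨k, by omega, z, hz⟩
      · exact short₁ a c i j y b x hac h1 h2 hyb hxb hx

theorem IsPerfectRanking.markovEquivalent (hH : H.IsRegressionChainGraph) {r : V → α}
    (hr : H.IsPerfectRanking r) : H.MarkovEquivalent (H.orient r) :=
  markovEquivalent_of_conn hH (H.isDAG_orient r).isRegressionChainGraph fun _ _ _ hac =>
    ⟨hr.conn_orient hH hac, hr.conn_of_conn_orient hH hac⟩

/-! ### Existence of a perfect ranking. -/

/-- The neighbours with an edge into `b`, together with `b` itself. -/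
def closedHeads (H : LooplessMixedGraph V) (b : V) : Set V :=
  {x | x = b ∨ H.HeadTo x b}

/-- Elements a and d of the two set differences would be the ends of a forbidden collider path. That
a is not adjacent to c holds because an arrow c → a would close a cycle through b. -/
theorem IsRegressionChainGraph.closedHeads_subset_or (hH : H.IsRegressionChainGraph)
    (hno : ∀ a b c d, H.IsColliderPathFour a b c d → ¬ H.Adj a c → ¬ H.Adj b d → False)
    {b c : V} (hbc : H.arc b c) :
    H.closedHeads b ⊆ H.closedHeads c ∨ H.closedHeads c ⊆ H.closedHeads b := by
  have key : ∀ {b c x}, H.arc b c → x ∈ H.closedHeads b → x ∉ H.closedHeads c →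
      H.HeadTo x b ∧ x ≠ c ∧ ¬ H.Adj x c := by
    intro b c x hbc hx hxc
    simp only [closedHeads, Set.mem_ofPred_eq, not_or] at hx hxc
    have hxb : x ≠ b := by
      rintro rfl
      exact hxc.2 (.inr hbc)
    have hx := hx.resolve_left hxb
    refine ⟨hx, hxc.1, fun h => ?_⟩
    rcases h.cases with h | h | h
    · exact hxc.2 h
    · exact hH.no_cycle _ _ h (.head hx (.single (.inr hbc)))
    · exact hH.not_headTo_of_line' h (.inr hbc)
  by_contra! hn
  obtain ⟨⟨a, ha, hac⟩, d, hd, hdb⟩ := Set.not_subset.1 hn.1, Set.not_subset.1 hn.2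
  obtain ⟨h1, h2, h3⟩ := key hbc ha hac
  obtain ⟨h4, h5, h6⟩ := key (H.arc_symm _ _ hbc) hd hdb
  refine hno a b c d ⟨?_, h1, hbc, h4⟩ h3 fun h => h6 h.symm
  have had : a ≠ d := by
    rintro rfl
    exact hac (.inr h4)
  have hab : a ≠ b := fun h => not_adj_self b (h ▸ h1.adj)
  have hcd : c ≠ d := fun h => not_adj_self d (h ▸ h4.adj)
  have hbc' : b ≠ c := fun h => H.arc_irrefl c (h ▸ hbc)
  simp [hab, h2, had, hbc', h5.symm, hcd]

/-- The rank is lexicographic. The size of `D` grows strictly along arrows and is constant along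
arcs; there the size of `closedHeads` decides, and by nestedness not being larger means being
contained. At endpoints of lines both sets are singletons, which leaves the elimination order. -/
theorem IsRegressionChainGraph.exists_isPerfectRanking [Finite V] (hH : H.IsRegressionChainGraph)
    (hno : ∀ a b c d, H.IsColliderPathFour a b c d → ¬ H.Adj a c → ¬ H.Adj b d → False)
    (hch : H.lineSubgraph.IsChordalGraph) :
    ∃ r : V → ℕ ×ₗ ℕ ×ₗ ℕ, H.IsPerfectRanking r := by
  obtain ⟨e, he, hel⟩ := hch.exists_elimination_order
  let D : V → Set V := fun v => {u | Relation.ReflTransGen H.HeadTo u v}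
  let r : V → ℕ ×ₗ ℕ ×ₗ ℕ := fun v =>
    toLex ((D v).ncard, toLex ((H.closedHeads v).ncard, e v))
  have hlt : ∀ u v, r u < r v ↔ (D u).ncard < (D v).ncard ∨ (D u).ncard = (D v).ncard ∧
      ((H.closedHeads u).ncard < (H.closedHeads v).ncard ∨
        (H.closedHeads u).ncard = (H.closedHeads v).ncard ∧ e u < e v) := by
    intro u v
    simp only [r, Prod.Lex.toLex_lt_toLex]
  have harc : ∀ u v, H.arc u v → D u ⊆ D v := fun u v h x hx => hx.tail (.inr h)
  have hline : ∀ {u v}, H.line u v → D u = {u} ∧ H.closedHeads u = {u} := by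
    intro u v h
    constructor
    · ext x
      refine ⟨fun hx => ?_, ?_⟩
      · rcases Relation.ReflTransGen.cases_tail hx with rfl | ⟨y, -, hy⟩
        · rfl
        · exact absurd hy (hH.not_headTo_of_line h)
      · rintro rfl
        exact .refl
    · ext x
      simp [closedHeads, hH.not_headTo_of_line h]
  refine ⟨r, ?_, ?_, ?_, ?_⟩
  · intro u v h
    simp only [r, EmbeddingLike.apply_eq_iff_eq, Prod.mk.injEq] at h
    exact he h.2.2
  · intro u v h
    rw [hlt]
    refine .inl (Set.ncard_lt_ncard ⟨fun x hx => hx.tail (.inl h), fun hs => ?_⟩)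
    exact hH.no_cycle _ _ h (hs (show v ∈ D v from .refl))
  · intro u v h hr x hxv
    have hD : D u = D v := (harc u v h).antisymm (harc v u (H.arc_symm _ _ h))
    have hsub : H.closedHeads u ⊆ H.closedHeads v := by
      rcases hH.closedHeads_subset_or hno h with hs | hs
      · exact hs
      · rw [hlt, hD] at hr
        have := Set.ncard_le_ncard hs
        exact (Set.eq_of_subset_of_ncard_le hs (by omega)).ge
    have hx : H.HeadTo x u → H.HeadTo x v := fun hx => (hsub (.inr hx)).resolve_left hxv
    constructor
    · exact fun hxu => (hx (.inl hxu)).resolve_right fun hxv =>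
        hH.no_cycle _ _ hxu (.head (.inr h) (.single (.inr (H.arc_symm _ _ hxv))))
    · exact fun hxu => (hx (.inr hxu)).resolve_left fun hxv =>
        hH.no_cycle _ _ hxv (.head (.inr (H.arc_symm _ _ h)) (.single (.inr (H.arc_symm _ _ hxu))))
  · intro u v w huw hvw huv hu hv
    have hu' := hline huw
    have hv' := hline hvw
    have hw' := hline (H.line_symm _ _ huw)
    rw [hlt, hu'.1, hu'.2, hw'.1, hw'.2] at hu
    rw [hlt, hv'.1, hv'.2, hw'.1, hw'.2] at hv
    simp only [Set.ncard_singleton] at hu hv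
    exact hel u v w huw hvw huv (by omega) (by omega)

/-! ### Restriction to chain components, and the corollary. -/

theorem induce_isColliderPathFour_iff {S : Set V} {a b c d : S} :
    (H.induce S).IsColliderPathFour a b c d ↔ H.IsColliderPathFour a b c d := by
  have : [a, b, c, d].Nodup ↔ [(a : V), b, c, d].Nodup :=
    (List.nodup_map_iff (f := ((↑) : S → V)) Subtype.val_injective (l := [a, b, c, d])).symm
  unfold IsColliderPathFour
  rw [this]
  rfl

/-- The inner nodes share a component because they are joined by an arc; each end is joined to it by
an arc or is a parent. So the local conditions exclude such paths globally. -/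
theorem IsChainPartition.mem_of_isColliderPathFour {T : ℕ} {τ : Fin T → Set V}
    (hτ : H.IsChainPartition τ) {a b c d : V} (h : H.IsColliderPathFour a b c d) :
    ∃ i, a ∈ τ i ∪ H.pa (τ i) ∧ b ∈ τ i ∧ c ∈ τ i ∧ d ∈ τ i ∪ H.pa (τ i) := by
  obtain ⟨-, hab, hbc, hdc⟩ := h
  have harc : ∀ {u v i}, H.arc u v → v ∈ τ i → u ∈ τ i := by
    intro u v i huv hv
    obtain ⟨j, hj⟩ := (hτ.cover u v (.inr huv)).1
    exact hτ.arc_within _ _ _ _ hj hv huv ▸ hj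
  obtain ⟨i, hb⟩ := (hτ.cover a b hab).2
  have hc := harc (H.arc_symm _ _ hbc) hb
  have hhead : ∀ {u v}, H.HeadTo u v → v ∈ τ i → u ∈ τ i ∪ H.pa (τ i) := fun h hv =>
    h.elim (fun h => .inr ⟨_, hv, h⟩) fun h => .inl (harc h hv)
  exact ⟨i, hhead hab hb, hb, hc, hhead hdc hc⟩

end LooplessMixedGraph

theorem mainTheorem5 {V : Type*} [Finite V] (H : LooplessMixedGraph V)
    (hH : H.IsRegressionChainGraph) {T : ℕ} (τ : Fin T → Set V) (hτ : H.IsChainPartition τ) :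
    (∃ G : LooplessMixedGraph V, G.IsDAG ∧ H.MarkovEquivalent G) ↔
      (H.lineSubgraph.IsChordalGraph ∧
        ∀ i : Fin T, ¬ (H.induce (τ i ∪ H.pa (τ i))).HasInducedColliderP4 ∧
          ¬ (H.induce (τ i ∪ H.pa (τ i))).HasInducedColliderC4) := by
  constructor
  · rintro ⟨G, hG, h⟩
    refine ⟨h.isChordalGraph hH hG, fun i => ⟨?_, ?_⟩⟩
    · rintro ⟨a, b, c, d, hp, hac, hbd, -⟩
      exact h.false_of_colliderPath hH hG
        (LooplessMixedGraph.induce_isColliderPathFour_iff.1 hp) hac hbd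
    · rintro ⟨a, b, c, d, hp, hac, hbd, -⟩
      exact h.false_of_colliderPath hH hG
        (LooplessMixedGraph.induce_isColliderPathFour_iff.1 hp) hac hbd
  · rintro ⟨hch, hτ'⟩
    obtain ⟨r, hr⟩ := hH.exists_isPerfectRanking (fun a b c d hp hac hbd => by
      obtain ⟨i, ha, hb, hc, hd⟩ := hτ.mem_of_isColliderPathFour hp
      have hp' : (H.induce (τ i ∪ H.pa (τ i))).IsColliderPathFour
          ⟨a, ha⟩ ⟨b, .inl hb⟩ ⟨c, .inl hc⟩ ⟨d, hd⟩ :=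
        LooplessMixedGraph.induce_isColliderPathFour_iff.2 hp
      -- P4 and C4 differ only in this adjacency; together they exclude both cases.
      by_cases had : H.Adj a d
      · exact (hτ' i).2 ⟨_, _, _, _, hp', hac, hbd, had⟩
      · exact (hτ' i).1 ⟨_, _, _, _, hp', hac, hbd, had⟩) hch
    exact ⟨H.orient r, H.isDAG_orient r, hr.markovEquivalent hH⟩
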